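/- Let $n\ge 1$ and let $\Theta=(\Theta_1,\dots,\Theta_n)$ and $X=(X_1,\dots,X_n)$ be random vectors on a common probability space with non-negative real components, where no $\Theta_i$ is almost surely $0$; no independence is assumed. Let $w_1,\dots,w_n>0$ with $\sum_{i=1}^n w_i=1$, and put $Y_i=\Theta_iX_i$ and $S_w=\sum_{i=1}^n w_iY_i$. Let $\alpha\in(0,\infty)$ and assume that $Y=(Y_1,\dots,Y_n)\in MRV(\alpha,V,\mu)$. This means: $V$ is a probability distribution on $\mathbb R$ whose tail $\overline V(x)=V((x,\infty))$ satisfies $\overline V(x)>0$ for all $x>0$ and $\overline V(tx)/\overline V(x)\to t^{-\alpha}$ as $x\to\infty$ for every $t>0$; $\mu$ is a non-zero Radon measure on $[0,\infty]^n\setminus\{0\}$; and $$\lim_{x\to\infty}\frac{1}{\overline V(x)}\,\mathbb P\left[\frac{Y}{x}\in B\right]=\mu(B)$$ for every Borel set $B\subseteq[0,\infty]^n\setminus\{0\}$ that is bounded away from $0$ (that is, $0\notin\overline B$) and satisfies $\mu(\partial B)=0$. Let $g:[0,1]\to[0,1]$ be a distortion function, that is, non-decreasing with $g(0)=0$ and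 $g(1)=1$, and assume that $\int_1^\infty g\big(y^{-\alpha/(1+\zeta)}\big)\,dy<\infty$ for some $\zeta>0$. For a non-negative random variable $Z$ and $p\in(0,1)$ let $$VaR_p(Z)=\inf\{x\in\mathbb R:\mathbb P(Z\le x)\ge p\},\qquad \rho_g[Z\mid Z>VaR_p(Z)]=\int_0^\infty g\big(\mathbb P(Z>x\mid Z>VaR_p(Z))\big)\,dx .$$ Then the limits $$\gamma_a:=\lim_{x\to\infty}\frac{\mathbb P\left(\sum_{i=1}^n a_iY_i>x\right)}{\mathbb P\left(\sum_{i=1}^n Y_i>x\right)}$$ exist for $a=w$ and for $a=e_j$, $j=1,\dots,n$ (the standard unit vectors), and are finite; $\gamma_w>0$ and $\Gamma_\alpha:=\sum_{j=1}^n\gamma_{e_j}^{1/\alpha}>0$; the constant $$C_\alpha(g):=\int_{(0,1]}y^{-1/\alpha}\,g(dy)=1+\int_1^\infty g\big(y^{-\alpha}\big)\,dy$$ is finite and its two expressions agree (where $g(dy)$ is the Lebesgue–Stieltjes measure induced by $g$); $\rho_g[S_w\mid S_w>VaR_p(S_w)]$ is finite for all $p<1$ sufficiently close to $1$; and $$\rho_g\left[S_w\mid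 S_w>VaR_p(S_w)\right]\;\sim\; C_\alpha(g)\,\frac{\gamma_w^{1/\alpha}}{\Gamma_\alpha}\sum_{i=1}^n VaR_p(\Theta_iX_i)\qquad\text{as } p\uparrow 1,$$ that is, the ratio of the two sides tends to $1$. -/

import Mathlib

open Set Filter Topology MeasureTheory
open scoped ENNReal

namespace BackgroundRisk

noncomputable section

/-- A distortion function: a non-decreasing `g : [0,1] → [0,1]` with `g 0 = 0` and `g 1 = 1`. -/
structure DistortionFunction where
  toFun : unitInterval → unitInterval
  monotone' : Monotone toFun
  map_zero' : toFun 0 = 0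
  map_one' : toFun 1 = 1

/-- The distortion function as a function on the line, constant outside `[0,1]`. -/
def DistortionFunction.extend (g : DistortionFunction) : ℝ → ℝ :=
  IccExtend zero_le_one (fun t : unitInterval => (g.toFun t : ℝ))

instance : CoeFun DistortionFunction (fun _ => ℝ → ℝ) := ⟨DistortionFunction.extend⟩

theorem DistortionFunction.monotone_extend (g : DistortionFunction) : Monotone g.extend :=
  Monotone.IccExtend (f := fun t : unitInterval => (g.toFun t : ℝ)) zero_le_one
    fun _ _ h => g.monotone' h

/-- The Lebesgue–Stieltjes measure `g(dy)`. -/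
def DistortionFunction.stieltjesMeasure (g : DistortionFunction) : Measure ℝ :=
  g.monotone_extend.stieltjesFunction.measure

/-- `C_α(g) = ∫_{(0,1]} y^{-1/α} g(dy)`. -/
def distortionConstant (g : DistortionFunction) (α : ℝ) : ℝ :=
  ∫ y in Ioc (0 : ℝ) 1, y ^ (-1 / α) ∂g.stieltjesMeasure

/-- A distribution `V` on the line has a regularly varying tail with index `α`, that is,
`V ∈ R_{-α}`: its tail is positive on `(0,∞)`, and it varies regularly at infinity. -/
def IsRegularlyVarying (V : Measure ℝ) (α : ℝ) : Prop :=
  (∀ x : ℝ, 0 < x → 0 < V.real (Ioi x)) ∧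
    ∀ t : ℝ, 0 < t →
      Tendsto (fun x : ℝ => V.real (Ioi (t * x)) / V.real (Ioi x)) atTop (𝓝 (t ^ (-α)))

variable {Ω : Type*} [MeasurableSpace Ω]

/-- The law under `P` of the non-negative random vector `Y` is multivariate regularly varying,
`Y ∈ MRV(α, V, μ)`. The limit measure lives on `[0,∞]^n \ {0}`; it is encoded as a measure on
`[0,∞]^n` without mass at the origin. It is non-zero and Radon (finite on the compact subsets of
the punctured space), and
`P[Y / x ∈ B] / V(x,∞) → μ(B)` for all Borel `B`, bounded away from the origin
(relatively compact in the punctured space), with `μ(∂B) = 0`. -/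
structure IsMRV (P : Measure Ω) {n : ℕ} (Y : Fin n → Ω → ℝ) (α : ℝ) (V : Measure ℝ)
    (μ : Measure (Fin n → ℝ≥0∞)) : Prop where
  isProbabilityMeasure : IsProbabilityMeasure V
  regularlyVarying : IsRegularlyVarying V α
  measure_zero : μ {0} = 0
  ne_zero : μ ≠ 0
  radon : ∀ K : Set (Fin n → ℝ≥0∞), IsCompact K → 0 ∉ K → μ K < ∞
  tendsto : ∀ B : Set (Fin n → ℝ≥0∞), MeasurableSet B → 0 ∉ closure B → μ (frontier B) = 0 →
    Tendsto (fun x : ℝ => P.real {ω | (fun i => ENNReal.ofReal (Y i ω / x)) ∈ B} / V.real (Ioi x))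
      atTop (𝓝 (μ B).toReal)

/-- The value at risk `VaR_p(Z) = inf {x : P(Z ≤ x) ≥ p}`. -/
def VaR (P : Measure Ω) (Z : Ω → ℝ) (p : ℝ) : ℝ :=
  sInf {x : ℝ | p ≤ P.real {ω | Z ω ≤ x}}

/-- The conditional tail `x ↦ P(Z > x | Z > VaR_p(Z))`. -/
def condTail (P : Measure Ω) (Z : Ω → ℝ) (p x : ℝ) : ℝ :=
  (ProbabilityTheory.cond P {ω | VaR P Z p < Z ω}).real {ω | x < Z ω}

/-- The tail distortion risk measure
`ρ_g[Z | Z > VaR_p(Z)] = ∫_0^∞ g(P(Z > x | Z > VaR_p(Z))) dx`. -/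
def tailDistortionRisk (P : Measure Ω) (g : DistortionFunction) (Z : Ω → ℝ) (p : ℝ) : ℝ :=
  ∫ x in Ioi (0 : ℝ), g (condTail P Z p x)

/-- The componentwise product `ΘX = (Θ₁X₁, …, ΘₙXₙ)`. -/
def hadamard {n : ℕ} (Θ X : Fin n → Ω → ℝ) (i : Fin n) (ω : Ω) : ℝ :=
  Θ i ω * X i ω

/-- The linear combination `∑ i, a i * Y i`. -/
def weightedSum {n : ℕ} (a : Fin n → ℝ) (Y : Fin n → Ω → ℝ) (ω : Ω) : ℝ :=
  ∑ i, a i * Y i ω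

/-- The ratio `P(∑ i, a i * Y i > x) / P(∑ i, Y i > x)`. -/
def tailRatio (P : Measure Ω) {n : ℕ} (Y : Fin n → Ω → ℝ) (a : Fin n → ℝ) (x : ℝ) : ℝ :=
  P.real {ω | x < weightedSum a Y ω} / P.real {ω | x < ∑ i, Y i ω}

/-- `γ_a`, the limit of `tailRatio` at infinity. -/
def gammaConst (P : Measure Ω) {n : ℕ} (Y : Fin n → Ω → ℝ) (a : Fin n → ℝ) : ℝ :=
  limUnder atTop (tailRatio P Y a)

/-- `Γ_α = ∑ i, γ_{e_i}^{1/α}`, with `e_i` the standard unit vectors. -/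
def GammaConst (P : Measure Ω) {n : ℕ} (Y : Fin n → Ω → ℝ) (α : ℝ) : ℝ :=
  ∑ i, gammaConst P Y (Pi.single i 1) ^ (1 / α)

end

end BackgroundRisk

open BackgroundRisk

/-! Every tail is compared with the reference tail of `V`. For `a ≥ 0` the set where `∑ a i * y i >
s` is bounded away from the origin, and for suitable `s` its boundary is `μ`-null. Hence P(∑ aᵢYᵢ >
x) / V(x,∞) has a finite limit c_a, positive as soon as the functional is not `μ`-a.e. zero
(`IsMRV.exists_tendsto_tail`). So γ_a = c_a / c_(1,…,1), and S = S_w inherits a regularly varying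
tail.

Let q = VaR_p(S), which tends to ∞ as p ↑ 1. Proportional regularly varying tails have proportional
quantiles, the constant being raised to the power 1/α (`tendsto_VaR_div_VaR`). Thus VaR_p(Yᵢ)/q →
(γ_{eᵢ}/γ_w)^(1/α), and the sum over i divided by q tends to Γ_α / γ_w^(1/α).

Substituting x = qy, the risk measure divided by q is the integral over y > 0 of g(P(S > q·max(y,1))
/ P(S > q)). The integrand tends a.e. to g(max(y,1)^(-α)). A Potter bound and the integrability
granted by ζ supply a dominating function (`tendsto_integral_distorted_ratio`), so the limit is 1 +
∫_1^∞ g(y^(-α)) dy. This is C_α(g) by the layer-cake formula. The claim is the quotient of the two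
limits. -/

namespace BackgroundRisk

/-! ### Tails of linear combinations under multivariate regular variation -/

/-- The linear functional `y ↦ ∑ i, a i * y i` on `[0,∞]^n`. -/
noncomputable def extLinear {n : ℕ} (a : Fin n → ℝ) (y : Fin n → ℝ≥0∞) : ℝ≥0∞ :=
  ∑ i, ENNReal.ofReal (a i) * y i

theorem continuous_extLinear {n : ℕ} (a : Fin n → ℝ) : Continuous (extLinear a) := by
  unfold extLinear
  exact continuous_finsetSum _ fun i _ =>
    (ENNReal.continuous_const_mul ENNReal.ofReal_ne_top).comp (continuous_apply i)

theorem extLinear_zero {n : ℕ} (a : Fin n → ℝ) : extLinear a 0 = 0 := by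
  simp [extLinear]

theorem extLinear_ne_zero {n : ℕ} {a : Fin n → ℝ} {y : Fin n → ℝ≥0∞} {i : Fin n}
    (ha : 0 < a i) (hy : y i ≠ 0) : extLinear a y ≠ 0 := by
  intro h
  have := (Finset.sum_eq_zero_iff.1 h) i (Finset.mem_univ i)
  rw [mul_eq_zero, ENNReal.ofReal_eq_zero] at this
  exact this.elim ha.not_ge hy

theorem extLinear_ofReal {n : ℕ} {a y : Fin n → ℝ} (ha : ∀ i, 0 ≤ a i) (hy : ∀ i, 0 ≤ y i)
    {x : ℝ} (hx : 0 < x) :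
    extLinear a (fun i => ENNReal.ofReal (y i / x)) = ENNReal.ofReal ((∑ i, a i * y i) / x) := by
  rw [Finset.sum_div, ENNReal.ofReal_sum_of_nonneg]
  · refine Finset.sum_congr rfl fun i _ => ?_
    rw [mul_div_assoc, ENNReal.ofReal_mul (ha i)]
  · exact fun i _ => div_nonneg (mul_nonneg (ha i) (hy i)) hx.le

variable {Ω : Type*} [MeasurableSpace Ω]

/-- Since `[0,∞]^n` is compact, a closed set that misses the origin is compact, so the Radon
property applies to it. -/
theorem IsMRV.measure_extLinear_ge_lt_top {P : Measure Ω} {n : ℕ} {Y : Fin n → Ω → ℝ} {α : ℝ}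
    {V : Measure ℝ} {μ : Measure (Fin n → ℝ≥0∞)} (h : IsMRV P Y α V μ) (a : Fin n → ℝ) {s : ℝ}
    (hs : 0 < s) : μ {y | ENNReal.ofReal s ≤ extLinear a y} < ∞ := by
  refine h.radon _ (isClosed_le continuous_const (continuous_extLinear a)).isCompact ?_
  simp [extLinear_zero, hs]

/-- Disjoint level sets inside a set of finite mass can have positive mass for only countably many
levels, while an interval of levels is uncountable. -/
theorem IsMRV.exists_null_level {P : Measure Ω} {n : ℕ} {Y : Fin n → Ω → ℝ} {α : ℝ}
    {V : Measure ℝ} {μ : Measure (Fin n → ℝ≥0∞)} (h : IsMRV P Y α V μ) (a : Fin n → ℝ) {ε : ℝ}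
    (hε : 0 < ε) : ∃ s ∈ Ioo 0 ε, μ {y | extLinear a y = ENNReal.ofReal s} = 0 := by
  -- Levels are sought above `ε / 2`, so that a single set of finite mass contains all the level
  -- sets concerned.
  set A : Set (Fin n → ℝ≥0∞) := {y | ENNReal.ofReal (ε / 2) ≤ extLinear a y} with hA
  have hAm : MeasurableSet A :=
    measurableSet_le measurable_const (continuous_extLinear a).measurable
  have : IsFiniteMeasure (μ.restrict A) :=
    ⟨by simpa using h.measure_extLinear_ge_lt_top a (half_pos hε)⟩
  have hc := Measure.countable_meas_level_set_pos (μ := μ.restrict A)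
    (continuous_extLinear a).measurable
  have hc' : (Ioo (ε / 2) ε ∩ ENNReal.ofReal ⁻¹' {t | 0 < μ.restrict A {y | extLinear a y = t}}).Countable := by
    refine Set.countable_of_injective_of_countable_image (f := ENNReal.ofReal) ?_
      (hc.mono ?_)
    · intro x hx y hy hxy
      exact (ENNReal.ofReal_eq_ofReal_iff (by linarith [hx.1.1]) (by linarith [hy.1.1])).1 hxy
    · rintro _ ⟨x, hx, rfl⟩
      exact hx.2
  have hne : ¬ (Ioo (ε / 2) ε ⊆ ENNReal.ofReal ⁻¹' {t | 0 < μ.restrict A {y | extLinear a y = t}}) := by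
    intro hsub
    rw [inter_eq_left.2 hsub] at hc'
    exact (Cardinal.Real.Ioo_countable_iff.not.2 (by linarith : ¬ ε ≤ ε / 2)) hc'
  obtain ⟨s, hs, hs'⟩ := not_subset.1 hne
  refine ⟨s, ⟨by linarith [hs.1], hs.2⟩, ?_⟩
  have h0 : μ.restrict A {y | extLinear a y = ENNReal.ofReal s} = 0 := by
    by_contra hcon
    exact hs' (pos_iff_ne_zero.2 hcon)
  rw [Measure.restrict_eq_self] at h0
  · exact h0
  · intro y hy
    rw [mem_ofPred_eq] at hy
    rw [hA, mem_ofPred_eq, hy]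
    exact ENNReal.ofReal_le_ofReal hs.1.le

/-- A null level makes the superlevel set a `μ`-continuity set, which gives the limit along `s * x`.
Replacing `x` by `s⁻¹ * x` and using regular variation of `V` brings in the factor `s ^ α`. One good
level suffices, and homogeneity of `μ` is not needed. -/
theorem IsMRV.tendsto_tail_of_null_level {P : Measure Ω} {n : ℕ} {Y : Fin n → Ω → ℝ} {α : ℝ}
    {V : Measure ℝ} {μ : Measure (Fin n → ℝ≥0∞)} (h : IsMRV P Y α V μ)
    (hY : ∀ i, ∀ᵐ ω ∂P, 0 ≤ Y i ω) {a : Fin n → ℝ} (ha : ∀ i, 0 ≤ a i) {s : ℝ} (hs : 0 < s)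
    (hs0 : μ {y | extLinear a y = ENNReal.ofReal s} = 0) :
    Tendsto (fun x : ℝ => P.real {ω | x < weightedSum a Y ω} / V.real (Ioi x)) atTop
      (𝓝 (s ^ α * (μ {y | ENNReal.ofReal s < extLinear a y}).toReal)) := by
  have hcl : closure {y | ENNReal.ofReal s < extLinear a y} ⊆
      {y | ENNReal.ofReal s ≤ extLinear a y} :=
    closure_lt_subset_le continuous_const (continuous_extLinear a)
  have hlim := h.tendsto {y | ENNReal.ofReal s < extLinear a y}
    (measurableSet_lt measurable_const (continuous_extLinear a).measurable)
    (fun h0 => hs.not_ge (by simpa [extLinear_zero] using hcl h0))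
    (measure_mono_null (frontier_lt_subset_eq continuous_const (continuous_extLinear a))
      (by simpa only [eq_comm] using hs0))
  have hlim' : Tendsto (fun x : ℝ => P.real {ω | s * x < weightedSum a Y ω} / V.real (Ioi x))
      atTop (𝓝 (μ {y | ENNReal.ofReal s < extLinear a y}).toReal) := by
    refine hlim.congr' ?_
    filter_upwards [eventually_gt_atTop 0] with x hx
    congr 1
    refine measureReal_congr ?_
    filter_upwards [ae_all_iff.2 hY] with ω hω
    apply propext
    change ENNReal.ofReal s < extLinear a _ ↔ s * x < weightedSum a Y ω
    rw [extLinear_ofReal ha hω hx, ENNReal.ofReal_lt_ofReal_iff_of_nonneg hs.le, lt_div_iff₀ hx,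
      weightedSum]
  have hdiv : Tendsto (fun x : ℝ => s⁻¹ * x) atTop atTop :=
    tendsto_id.const_mul_atTop (inv_pos.2 hs)
  have h2 := (hlim'.comp hdiv).mul (h.regularlyVarying.2 s⁻¹ (inv_pos.2 hs))
  rw [Real.inv_rpow hs.le, Real.rpow_neg hs.le, inv_inv, mul_comm] at h2
  refine h2.congr' ?_
  filter_upwards [eventually_gt_atTop 0] with x hx
  have hV := h.regularlyVarying.1 (s⁻¹ * x) (by positivity)
  simp only [Function.comp_apply]
  rw [mul_inv_cancel_left₀ hs.ne', div_mul_div_cancel₀ hV.ne']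

/-- The tail of a linear combination with non-negative coefficients of a multivariate regularly
varying vector is asymptotically proportional to the reference tail. -/
theorem IsMRV.exists_tendsto_tail {P : Measure Ω} {n : ℕ} {Y : Fin n → Ω → ℝ} {α : ℝ}
    {V : Measure ℝ} {μ : Measure (Fin n → ℝ≥0∞)} (h : IsMRV P Y α V μ)
    (hY : ∀ i, ∀ᵐ ω ∂P, 0 ≤ Y i ω) {a : Fin n → ℝ} (ha : ∀ i, 0 ≤ a i) :
    ∃ c : ℝ, 0 ≤ c ∧ (μ {y | extLinear a y ≠ 0} ≠ 0 → 0 < c) ∧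
      Tendsto (fun x : ℝ => P.real {ω | x < weightedSum a Y ω} / V.real (Ioi x)) atTop (𝓝 c) := by
  by_cases h0 : μ {y | extLinear a y ≠ 0} = 0
  · obtain ⟨s, hs, hs0⟩ := h.exists_null_level a one_pos
    exact ⟨_, mul_nonneg (Real.rpow_nonneg hs.1.le _) ENNReal.toReal_nonneg,
      fun h' => absurd h0 h', h.tendsto_tail_of_null_level hY ha hs.1 hs0⟩
  -- For a positive constant the level must be low enough for its superlevel set to carry mass. The
  -- superlevel sets exhaust `{extLinear a y ≠ 0}`, so one of them is not null, and any lower level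
  -- inherits this.
  · have hU : {y | extLinear a y ≠ 0} ⊆
        ⋃ k : ℕ, {y | ENNReal.ofReal (1 / ((k : ℝ) + 1)) < extLinear a y} := by
      intro y hy
      rw [mem_ofPred_eq] at hy
      obtain ⟨k, hk⟩ := ENNReal.exists_inv_nat_lt hy
      refine mem_iUnion.2 ⟨k, lt_of_le_of_lt ?_ hk⟩
      rw [one_div, ENNReal.ofReal_inv_of_pos (by positivity), ENNReal.inv_le_inv,
        ← ENNReal.ofReal_natCast k]
      exact ENNReal.ofReal_le_ofReal (by linarith)
    obtain ⟨k, hk⟩ : ∃ k : ℕ, μ {y | ENNReal.ofReal (1 / ((k : ℝ) + 1)) < extLinear a y} ≠ 0 := by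
      by_contra! hall
      exact h0 (measure_mono_null hU (measure_iUnion_null hall))
    obtain ⟨s, hs, hs0⟩ := h.exists_null_level a (ε := 1 / ((k : ℝ) + 1)) (by positivity)
    have hsub : {y | ENNReal.ofReal (1 / ((k : ℝ) + 1)) < extLinear a y} ⊆
        {y | ENNReal.ofReal s < extLinear a y} := fun y hy =>
      lt_of_le_of_lt (ENNReal.ofReal_le_ofReal hs.2.le) hy
    have hpos : μ {y | ENNReal.ofReal s < extLinear a y} ≠ 0 := fun h' =>
      hk (measure_mono_null hsub h')
    have hfin : μ {y | ENNReal.ofReal s < extLinear a y} ≠ ∞ :=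
      (lt_of_le_of_lt (measure_mono (ofPred_subset_ofPred.2 fun y hy => le_of_lt hy))
        (h.measure_extLinear_ge_lt_top a hs.1)).ne
    have hc := mul_pos (Real.rpow_pos_of_pos hs.1 α) (ENNReal.toReal_pos hpos hfin)
    exact ⟨_, hc.le, fun _ => hc, h.tendsto_tail_of_null_level hY ha hs.1 hs0⟩

/-! ### Value at risk as the generalized inverse of the tail -/

/-- The Galois connection between quantile and distribution function: right-continuity of the latter
makes the infimum attained. -/
theorem VaR_le_iff (P : Measure Ω) [IsProbabilityMeasure P] {Z : Ω → ℝ} (hZ : Measurable Z)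
    {p : ℝ} (hp0 : 0 < p) (hp1 : p < 1) (x : ℝ) :
    VaR P Z p ≤ x ↔ P.real {ω | x < Z ω} ≤ 1 - p := by
  have : IsProbabilityMeasure (P.map Z) := Measure.isProbabilityMeasure_map hZ.aemeasurable
  set F := ProbabilityTheory.cdf (P.map Z)
  have hF : ∀ x, F x = P.real {ω | Z ω ≤ x} := fun x => by
    rw [ProbabilityTheory.cdf_eq_real, map_measureReal_apply hZ measurableSet_Iic]
    rfl
  have hS : {x : ℝ | p ≤ P.real {ω | Z ω ≤ x}} = {x | p ≤ F x} := by simp only [hF]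
  have hmono : Monotone F := F.mono
  have hbdd : BddBelow {x | p ≤ F x} := by
    obtain ⟨b, hb⟩ := ((ProbabilityTheory.tendsto_cdf_atBot (P.map Z)).eventually_lt_const
      hp0).exists
    exact ⟨b, fun x hx => le_of_not_gt fun hlt =>
      absurd (hmono hlt.le) (not_le.2 (lt_of_lt_of_le hb hx))⟩
  have hne : {x | p ≤ F x}.Nonempty := by
    obtain ⟨b, hb⟩ := ((ProbabilityTheory.tendsto_cdf_atTop (P.map Z)).eventually_const_lt
      hp1).exists
    exact ⟨b, hb.le⟩
  have hcompl : P.real {ω | x < Z ω} = 1 - F x := by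
    rw [hF, ← probReal_compl_eq_one_sub (measurableSet_le hZ measurable_const)]
    congr 1
    ext ω
    simp
  rw [hcompl, VaR, hS, sub_le_sub_iff_left]
  refine ⟨fun h => ?_, fun h => csInf_le hbdd h⟩
  have hev : ∀ᶠ y in 𝓝[>] x, p ≤ F y := by
    filter_upwards [self_mem_nhdsWithin] with y hy
    obtain ⟨z, hz, hzy⟩ := exists_lt_of_csInf_lt hne (lt_of_le_of_lt h hy)
    exact le_trans hz (hmono hzy.le)
  exact ge_of_tendsto ((F.right_continuous x).mono Ioi_subset_Ici_self) hev

theorem lt_VaR_iff (P : Measure Ω) [IsProbabilityMeasure P] {Z : Ω → ℝ} (hZ : Measurable Z)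
    {p : ℝ} (hp0 : 0 < p) (hp1 : p < 1) (x : ℝ) :
    x < VaR P Z p ↔ 1 - p < P.real {ω | x < Z ω} := by
  simpa only [not_le] using (VaR_le_iff P hZ hp0 hp1 x).not

theorem VaR_nonneg (P : Measure Ω) [IsProbabilityMeasure P] {Z : Ω → ℝ} (hZ : Measurable Z)
    (hZ0 : ∀ᵐ ω ∂P, 0 ≤ Z ω) {p : ℝ} (hp0 : 0 < p) (hp1 : p < 1) : 0 ≤ VaR P Z p := by
  refine le_of_forall_lt fun x hx => (lt_VaR_iff P hZ hp0 hp1 x).2 ?_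
  have : P.real {ω | x < Z ω} = 1 := by
    rw [← probReal_univ (μ := P)]
    refine measureReal_congr ?_
    filter_upwards [hZ0] with ω hω
    exact propext ⟨fun _ => trivial, fun _ => lt_of_lt_of_le hx hω⟩
  linarith

theorem eventually_mem_Ioo_zero_one : ∀ᶠ p in 𝓝[<] (1 : ℝ), 0 < p ∧ p < 1 :=
  Ioo_mem_nhdsLT zero_lt_one

theorem tendsto_VaR_atTop (P : Measure Ω) [IsProbabilityMeasure P] {Z : Ω → ℝ}
    (hZ : Measurable Z) (hpos : ∀ x, 0 < P.real {ω | x < Z ω}) :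
    Tendsto (VaR P Z) (𝓝[<] 1) atTop := by
  refine tendsto_atTop.2 fun M => ?_
  have h1 : 1 - P.real {ω | M < Z ω} < 1 := by linarith [hpos M]
  filter_upwards [eventually_mem_Ioo_zero_one, mem_nhdsWithin_of_mem_nhds (Ioi_mem_nhds h1)]
    with p hp hp'
  refine ((lt_VaR_iff P hZ hp.1 hp.2 M).2 ?_).le
  rw [mem_Ioi] at hp'
  linarith

/-- If the tail of `Z` is asymptotically `r` times the regularly varying tail of `S`, then the
value at risk of `Z` is asymptotically `r ^ (1 / α)` times that of `S`. -/
theorem tendsto_VaR_div_VaR (P : Measure Ω) [IsProbabilityMeasure P] {Z S : Ω → ℝ}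
    (hZ : Measurable Z) (hS : Measurable S) (hZ0 : ∀ᵐ ω ∂P, 0 ≤ Z ω) {α r : ℝ} (hα : 0 < α)
    (hr : 0 ≤ r) (hpos : ∀ x, 0 < P.real {ω | x < S ω})
    (hRV : ∀ t : ℝ, 0 < t →
      Tendsto (fun x => P.real {ω | t * x < S ω} / P.real {ω | x < S ω}) atTop (𝓝 (t ^ (-α))))
    (hlim : Tendsto (fun x => P.real {ω | x < Z ω} / P.real {ω | x < S ω}) atTop (𝓝 r)) :
    Tendsto (fun p => VaR P Z p / VaR P S p) (𝓝[<] 1) (𝓝 (r ^ (1 / α))) := by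
  have hq := tendsto_VaR_atTop P hS hpos
  have hqpos := hq.eventually_gt_atTop 0
  have hscale : ∀ m : ℝ, 0 < m →
      Tendsto (fun x => P.real {ω | m * x < Z ω} / P.real {ω | x < S ω}) atTop
        (𝓝 (r * m ^ (-α))) := fun m hm => by
    have h := (hlim.comp (tendsto_id.const_mul_atTop hm)).mul (hRV m hm)
    refine h.congr fun x => ?_
    exact div_mul_div_cancel₀ (hpos _).ne'
  have hroot : (r ^ (1 / α)) ^ α = r := by
    rw [← Real.rpow_mul hr, one_div_mul_cancel hα.ne', Real.rpow_one]
  rw [tendsto_order]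
  constructor
  · intro l hl
    rcases lt_or_ge l 0 with hl0 | hl0
    · filter_upwards [eventually_mem_Ioo_zero_one, hqpos] with p hp hqp
      exact lt_of_lt_of_le hl0 (div_nonneg (VaR_nonneg P hZ hZ0 hp.1 hp.2) hqp.le)
    -- At q = `VaR P S p` only P(S > q) ≤ 1 - p is known, but strictly below q the tail exceeds 1 -
    -- p. Hence the tails are compared at `(s / m) * q < q`, where `m < r ^ (1 / α)` makes the tail
    -- of `Z` at `m * ((s / m) * q) = s * q` the larger one.
    · obtain ⟨s, hls, hs⟩ := exists_between hl
      obtain ⟨m, hsm, hm⟩ := exists_between hs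
      have hs0 : 0 < s := lt_of_le_of_lt hl0 hls
      have hm0 : 0 < m := hs0.trans hsm
      have hu0 : 0 < s / m := div_pos hs0 hm0
      have hu1 : s / m < 1 := (div_lt_one hm0).2 hsm
      have hgt : 1 < r * m ^ (-α) := by
        rw [Real.rpow_neg hm0.le, ← div_eq_mul_inv, one_lt_div (Real.rpow_pos_of_pos hm0 α)]
        calc m ^ α < (r ^ (1 / α)) ^ α := Real.rpow_lt_rpow hm0.le hm hα
          _ = r := hroot
      have hev := (hq.const_mul_atTop hu0).eventually
        ((hscale m hm0).eventually_const_lt hgt)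
      filter_upwards [eventually_mem_Ioo_zero_one, hqpos, hev] with p hp hqp h
      rw [one_lt_div (hpos _)] at h
      have h1 := (lt_VaR_iff P hS hp.1 hp.2 (s / m * VaR P S p)).1 (by nlinarith)
      rw [← mul_assoc, mul_div_cancel₀ _ hm0.ne'] at h
      have h2 := (lt_VaR_iff P hZ hp.1 hp.2 _).2 (h1.trans h)
      exact hls.trans ((lt_div_iff₀ hqp).2 h2)
  · intro u hu
    obtain ⟨s, hs, hsu⟩ := exists_between hu
    have hs0 : 0 < s := lt_of_le_of_lt (Real.rpow_nonneg hr _) hs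
    have hlt : r * s ^ (-α) < 1 := by
      rw [Real.rpow_neg hs0.le, ← div_eq_mul_inv, div_lt_one (Real.rpow_pos_of_pos hs0 α)]
      calc r = (r ^ (1 / α)) ^ α := hroot.symm
        _ < s ^ α := Real.rpow_lt_rpow (Real.rpow_nonneg hr _) hs hα
    have hev := hq.eventually ((hscale s hs0).eventually_lt_const hlt)
    filter_upwards [eventually_mem_Ioo_zero_one, hqpos, hev] with p hp hqp h
    rw [div_lt_one (hpos _)] at h
    have h1 := (VaR_le_iff P hS hp.1 hp.2 _).1 le_rfl
    have h2 := (VaR_le_iff P hZ hp.1 hp.2 _).2 (h.le.trans h1)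
    exact lt_of_le_of_lt ((div_le_iff₀ hqp).2 h2) hsu

/-! ### Distortion functions and the two forms of C_α(g) -/

namespace DistortionFunction

variable (g : DistortionFunction)

theorem extend_nonneg (x : ℝ) : 0 ≤ g x := (g.toFun _).2.1

theorem extend_le_one (x : ℝ) : g x ≤ 1 := (g.toFun _).2.2

theorem extend_of_one_le {x : ℝ} (hx : 1 ≤ x) : g x = 1 := by
  rw [extend, IccExtend_of_right_le _ _ hx]
  exact congrArg Subtype.val g.map_one'

theorem antitoneOn_extend_one_div_rpow {β : ℝ} (hβ : 0 < β) :
    AntitoneOn (fun y : ℝ => g (1 / y ^ β)) (Ioi 1) := fun x hx y _ hxy => by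
  have hx0 : (0 : ℝ) < x := zero_lt_one.trans hx
  exact g.monotone_extend (one_div_le_one_div_of_le (Real.rpow_pos_of_pos hx0 β)
    (Real.rpow_le_rpow hx0.le hxy hβ.le))

theorem aestronglyMeasurable_one_div_rpow {β : ℝ} (hβ : 0 < β) :
    AEStronglyMeasurable (fun y : ℝ => g (1 / y ^ β)) (volume.restrict (Ioi 1)) :=
  (aemeasurable_restrict_of_antitoneOn measurableSet_Ioi
    (g.antitoneOn_extend_one_div_rpow hβ)).aestronglyMeasurable

theorem integrableOn_one_div_rpow_mono {β γ : ℝ} (hβ : 0 < β) (hβγ : β ≤ γ)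
    (h : IntegrableOn (fun y : ℝ => g (1 / y ^ β)) (Ioi 1)) :
    IntegrableOn (fun y : ℝ => g (1 / y ^ γ)) (Ioi 1) := by
  refine Integrable.mono' h (g.aestronglyMeasurable_one_div_rpow (hβ.trans_le hβγ)) ?_
  filter_upwards [ae_restrict_mem measurableSet_Ioi] with y hy
  rw [mem_Ioi] at hy
  rw [Real.norm_of_nonneg (g.extend_nonneg _)]
  exact g.monotone_extend (one_div_le_one_div_of_le (Real.rpow_pos_of_pos (by linarith) β)
    (Real.rpow_le_rpow_of_exponent_le hy.le hβγ))

/-- Along `y ↦ y ^ (-α)`, almost every point of `(1,∞)` avoids a given countable set. -/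
theorem ae_one_div_rpow_notMem {α : ℝ} (hα : 0 < α) {D : Set ℝ} (hD : D.Countable) :
    ∀ᵐ y ∂volume.restrict (Ioi (1 : ℝ)), 1 / y ^ α ∉ D := by
  have hc : (Ioi (1 : ℝ) ∩ (fun y => 1 / y ^ α) ⁻¹' D).Countable := by
    refine Set.countable_of_injective_of_countable_image (f := fun y : ℝ => 1 / y ^ α) ?_
      (hD.mono ?_)
    · intro x hx y hy hxy
      have hx0 : (0 : ℝ) < x := zero_lt_one.trans hx.1
      have hy0 : (0 : ℝ) < y := zero_lt_one.trans hy.1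
      simp only [one_div, inv_inj] at hxy
      exact (Real.rpow_left_inj hx0.le hy0.le hα.ne').1 hxy
    · rintro _ ⟨x, hx, rfl⟩
      exact hx.2
  filter_upwards [ae_restrict_mem measurableSet_Ioi, ae_restrict_of_ae (hc.ae_notMem volume)]
    with y hy hy' hyD
  exact hy' ⟨hy, hyD⟩

/-- A jump of `g` at 0 would bound the integrand below by a positive constant on a half-line of
infinite length. -/
theorem rightLim_zero {α : ℝ}
    (h : IntegrableOn (fun y : ℝ => g (1 / y ^ α)) (Ioi 1)) :
    Function.rightLim g.extend 0 = 0 := by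
  have h0 : 0 ≤ Function.rightLim g.extend 0 :=
    (g.extend_nonneg 0).trans (g.monotone_extend.le_rightLim le_rfl)
  by_contra hne
  have hconst : IntegrableOn (fun _ : ℝ => Function.rightLim g.extend 0) (Ioi 1) := by
    refine Integrable.mono' h aestronglyMeasurable_const ?_
    filter_upwards [ae_restrict_mem measurableSet_Ioi] with y hy
    rw [Real.norm_of_nonneg h0]
    have hy0 : (0 : ℝ) < y := zero_lt_one.trans hy
    exact g.monotone_extend.rightLim_le (one_div_pos.2 (Real.rpow_pos_of_pos hy0 α))
  rw [integrableOn_const_iff] at hconst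
  simp [hne] at hconst

/-- Layer-cake formula: for t < 1 the superlevel set is all of (0,1], of mass 1, and for t > 1 it is
(0, t^(-α)), of mass g(t^(-α)) for almost every t. -/
theorem lintegral_rpow_stieltjesMeasure {α : ℝ} (hα : 0 < α)
    (h : IntegrableOn (fun y : ℝ => g (1 / y ^ α)) (Ioi 1)) :
    ∫⁻ y in Ioc 0 1, ENNReal.ofReal (y ^ (-1 / α)) ∂g.stieltjesMeasure =
      1 + ∫⁻ y in Ioi 1, ENNReal.ofReal (g (1 / y ^ α)) := by
  set F := g.monotone_extend.stieltjesFunction with hF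
  have hF0 : F 0 = 0 := by rw [hF, Monotone.stieltjesFunction_eq, g.rightLim_zero h]
  have hF1 : F 1 = 1 := by
    rw [hF, Monotone.stieltjesFunction_eq]
    refine rightLim_eq_of_tendsto (tendsto_const_nhds.congr' ?_)
    filter_upwards [self_mem_nhdsWithin] with y hy
    exact (g.extend_of_one_le (le_of_lt hy)).symm
  rw [lintegral_eq_lintegral_meas_lt]
  rotate_left
  · filter_upwards [ae_restrict_mem measurableSet_Ioc] with y hy
    exact Real.rpow_nonneg hy.1.le _
  · exact (measurable_id.pow_const _).aemeasurable
  rw [← Ioc_union_Ioi_eq_Ioi zero_le_one, lintegral_union measurableSet_Ioi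
    (Ioc_disjoint_Ioi le_rfl)]
  have hset : ∀ t : ℝ, (g.stieltjesMeasure.restrict (Ioc 0 1)) {a | t < a ^ (-1 / α)} =
      F.measure ({a | t < a ^ (-1 / α)} ∩ Ioc 0 1) := fun t =>
    Measure.restrict_apply (measurableSet_lt measurable_const (measurable_id.pow_const _))
  have hneg : -1 / α < 0 := div_neg_of_neg_of_pos (by norm_num) hα
  congr 1
  -- The endpoint t = 1 is dropped because its superlevel set omits the point 1, where the measure
  -- may have an atom.
  · calc ∫⁻ t in Ioc (0 : ℝ) 1, (g.stieltjesMeasure.restrict (Ioc 0 1)) {a | t < a ^ (-1 / α)}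
        = ∫⁻ t in Ioo (0 : ℝ) 1, (g.stieltjesMeasure.restrict (Ioc 0 1)) {a | t < a ^ (-1 / α)} :=
          setLIntegral_congr Ioo_ae_eq_Ioc.symm
      _ = ∫⁻ t in Ioo (0 : ℝ) 1, 1 := by
          refine setLIntegral_congr_fun measurableSet_Ioo fun t ht => ?_
          simp only [hset]
          rw [inter_eq_right.2, StieltjesFunction.measure_Ioc, hF0, hF1]
          · simp
          · intro a ha
            exact lt_of_lt_of_le ht.2 (Real.one_le_rpow_of_pos_of_le_one_of_nonpos ha.1 ha.2 hneg.le)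
      _ = 1 := by simp
  · refine lintegral_congr_ae ?_
    -- The mass of the open interval is a left limit of `F`, itself the right-limit version of `g`.
    -- Off the countably many discontinuities of both functions it equals the value of `g`.
    filter_upwards [ae_restrict_mem measurableSet_Ioi,
      ae_one_div_rpow_notMem hα g.monotone_extend.countable_not_continuousAt,
      ae_one_div_rpow_notMem hα F.mono.countable_not_continuousAt] with t ht hg hFc
    rw [not_not] at hg hFc
    rw [mem_Ioi] at ht
    have ht0 : 0 < t := zero_lt_one.trans ht
    have hinv : (1 / t ^ α) = t ^ (-α) := by rw [Real.rpow_neg ht0.le, one_div]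
    have hlt1 : 1 / t ^ α < 1 := by
      rw [hinv]; exact Real.rpow_lt_one_of_one_lt_of_neg ht (neg_neg_of_pos hα)
    have hpow : (1 / t ^ α) ^ (-1 / α) = t := by
      rw [hinv, ← Real.rpow_mul ht0.le]
      rw [show -α * (-1 / α) = 1 by field_simp, Real.rpow_one]
    have hpos : 0 < 1 / t ^ α := one_div_pos.2 (Real.rpow_pos_of_pos ht0 α)
    have hIoo : {a | t < a ^ (-1 / α)} ∩ Ioc 0 1 = Ioo 0 (1 / t ^ α) := by
      ext a
      constructor
      · rintro ⟨h1, h2⟩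
        refine ⟨h2.1, lt_of_not_ge fun hge => ?_⟩
        have := Real.rpow_le_rpow_of_nonpos hpos hge hneg.le
        rw [hpow] at this
        exact absurd h1 (not_lt.2 this)
      · rintro ⟨h1, h2⟩
        refine ⟨?_, h1, (h2.trans hlt1).le⟩
        have := Real.rpow_lt_rpow_of_neg h1 h2 hneg
        rwa [hpow] at this
    rw [hset, hIoo, StieltjesFunction.measure_Ioo, hF0, sub_zero]
    congr 1
    rw [leftLim_eq_of_tendsto (hFc.tendsto.mono_left nhdsWithin_le_nhds), hF,
      Monotone.stieltjesFunction_eq,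
      rightLim_eq_of_tendsto (hg.tendsto.mono_left nhdsWithin_le_nhds)]

theorem integrableOn_rpow_stieltjesMeasure {α : ℝ} (hα : 0 < α)
    (h : IntegrableOn (fun y : ℝ => g (1 / y ^ α)) (Ioi 1)) :
    IntegrableOn (fun y : ℝ => y ^ (-1 / α)) (Ioc 0 1) g.stieltjesMeasure := by
  refine ⟨(measurable_id.pow_const _).aestronglyMeasurable, ?_⟩
  rw [hasFiniteIntegral_iff_ofReal]
  · rw [g.lintegral_rpow_stieltjesMeasure hα h]
    exact ENNReal.add_lt_top.2 ⟨ENNReal.one_lt_top,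
      (hasFiniteIntegral_iff_ofReal (ae_of_all _ fun y => g.extend_nonneg _)).1 h.2⟩
  · filter_upwards [ae_restrict_mem measurableSet_Ioc] with y hy
    exact Real.rpow_nonneg hy.1.le _

theorem distortionConstant_eq {α : ℝ} (hα : 0 < α)
    (h : IntegrableOn (fun y : ℝ => g (1 / y ^ α)) (Ioi 1)) :
    distortionConstant g α = 1 + ∫ y in Ioi (1 : ℝ), g (1 / y ^ α) := by
  have hnn : 0 ≤ᵐ[volume.restrict (Ioi (1 : ℝ))] fun y : ℝ => g (1 / y ^ α) :=
    ae_of_all _ fun y => g.extend_nonneg _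
  rw [distortionConstant, integral_eq_lintegral_of_nonneg_ae,
    g.lintegral_rpow_stieltjesMeasure hα h, integral_eq_lintegral_of_nonneg_ae hnn h.1,
    ENNReal.toReal_add ENNReal.one_ne_top ((hasFiniteIntegral_iff_ofReal hnn).1 h.2).ne,
    ENNReal.toReal_one]
  · filter_upwards [ae_restrict_mem measurableSet_Ioc] with y hy
    exact Real.rpow_nonneg hy.1.le _
  · exact (measurable_id.pow_const _).aestronglyMeasurable

end DistortionFunction

/-! ### Potter bound and dominated convergence -/

/-- A Potter-type upper bound for a non-increasing regularly varying function. -/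
theorem exists_potter_bound {T : ℝ → ℝ} (hT : Antitone T) (hpos : ∀ x, 0 < T x) {α β : ℝ}
    (hβ : 0 < β) (hβα : β < α)
    (hRV : Tendsto (fun x => T (2 * x) / T x) atTop (𝓝 (2 ^ (-α)))) :
    ∃ x₀ : ℝ, 0 < x₀ ∧ ∀ x, x₀ ≤ x → ∀ y, 1 ≤ y → T (x * y) / T x ≤ 2 ^ β * y ^ (-β) := by
  have hlt : (2 : ℝ) ^ (-α) < 2 ^ (-β) :=
    Real.rpow_lt_rpow_of_exponent_lt one_lt_two (neg_lt_neg hβα)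
  obtain ⟨x₀, hx₀⟩ := eventually_atTop.1 (hRV.eventually_lt_const hlt)
  refine ⟨max x₀ 1, lt_max_of_lt_right one_pos, fun x hx y hy => ?_⟩
  have hx0 : 0 < x := lt_of_lt_of_le one_pos ((le_max_right _ _).trans hx)
  have hstep : ∀ k : ℕ, T (2 ^ k * x) ≤ (2 ^ (-β)) ^ k * T x := by
    intro k
    induction k with
    | zero => simp
    | succ k ih =>
      have hle : x₀ ≤ 2 ^ k * x := ((le_max_left _ _).trans hx).trans
        (le_mul_of_one_le_left hx0.le (one_le_pow₀ one_le_two))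
      have h1 := (div_le_iff₀ (hpos _)).1 (hx₀ _ hle).le
      calc T (2 ^ (k + 1) * x) = T (2 * (2 ^ k * x)) := by ring_nf
        _ ≤ 2 ^ (-β) * T (2 ^ k * x) := h1
        _ ≤ 2 ^ (-β) * ((2 ^ (-β)) ^ k * T x) := by gcongr
        _ = (2 ^ (-β)) ^ (k + 1) * T x := by ring
  -- Dyadic bracketing `2 ^ k ≤ y < 2 ^ (k + 1)`; the unused last doubling costs the factor `2 ^ β`.
  obtain ⟨k, hk1, hk2⟩ := exists_nat_pow_near hy one_lt_two
  rw [div_le_iff₀ (hpos x)]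
  have hy0 : 0 < y := one_pos.trans_le hy
  calc T (x * y) ≤ T (2 ^ k * x) := hT (by nlinarith)
    _ ≤ (2 ^ (-β)) ^ k * T x := hstep k
    _ ≤ 2 ^ β * y ^ (-β) * T x := by
      refine mul_le_mul_of_nonneg_right ?_ (hpos x).le
      have hy2 : ((2 : ℝ) ^ (k + 1)) ^ (-β) ≤ y ^ (-β) :=
        Real.rpow_le_rpow_of_nonpos hy0 hk2.le (neg_nonpos.2 hβ.le)
      calc ((2 : ℝ) ^ (-β)) ^ k = 2 ^ β * ((2 : ℝ) ^ (k + 1)) ^ (-β) := by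
            rw [← Real.rpow_natCast, ← Real.rpow_natCast, ← Real.rpow_mul zero_le_two,
              ← Real.rpow_mul zero_le_two, ← Real.rpow_add zero_lt_two]
            congr 1
            push_cast
            ring
        _ ≤ 2 ^ β * y ^ (-β) := by gcongr

/-- Dominated convergence for the distorted tail ratios of a regularly varying tail. -/
theorem tendsto_integral_distorted_ratio {T : ℝ → ℝ} (hT : Antitone T) (hpos : ∀ x, 0 < T x)
    {α ζ : ℝ} (hα : 0 < α) (hζ : 0 < ζ)
    (hRV : ∀ t : ℝ, 0 < t → Tendsto (fun x => T (t * x) / T x) atTop (𝓝 (t ^ (-α))))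
    (g : DistortionFunction)
    (hg : IntegrableOn (fun y : ℝ => g (1 / y ^ (α / (1 + ζ)))) (Ioi 1)) :
    (∀ᶠ x in atTop, IntegrableOn (fun y => g (T (x * max y 1) / T x)) (Ioi 0)) ∧
      Tendsto (fun x => ∫ y in Ioi (0 : ℝ), g (T (x * max y 1) / T x)) atTop
        (𝓝 (1 + ∫ y in Ioi (1 : ℝ), g (1 / y ^ α))) := by
  set β := α / (1 + ζ) with hβ
  have hβ0 : 0 < β := by positivity
  have hβα : β < α := div_lt_self hα (by linarith)
  -- The Potter bound is taken with an exponent strictly above `β`, so that for large `y` the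
  -- surplus `y ^ (γ - β)` absorbs the constant `2 ^ γ`, which could not be pulled out of `g`.
  obtain ⟨γ, hβγ, hγα⟩ := exists_between hβα
  have hγ0 : 0 < γ := hβ0.trans hβγ
  obtain ⟨x₀, hx₀, hpot⟩ := exists_potter_bound hT hpos hγ0 hγα (hRV 2 two_pos)
  have hev : ∀ᶠ y : ℝ in atTop, 2 ^ γ ≤ y ^ (γ - β) :=
    (tendsto_rpow_atTop (sub_pos.2 hβγ)).eventually_ge_atTop _
  obtain ⟨y₀, hy₀⟩ := eventually_atTop.1 hev
  have hbound : ∀ x, x₀ ≤ x → ∀ y, max y₀ 1 < y → g (T (x * max y 1) / T x) ≤ g (1 / y ^ β) := by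
    intro x hx y hy
    have hy1 : 1 < y := (le_max_right _ _).trans_lt hy
    have hy0 : 0 < y := one_pos.trans hy1
    rw [max_eq_left hy1.le]
    refine g.monotone_extend ((hpot x hx y hy1.le).trans ?_)
    calc 2 ^ γ * y ^ (-γ) ≤ y ^ (γ - β) * y ^ (-γ) := by
          gcongr
          exact hy₀ y ((le_max_left _ _).trans hy.le)
      _ = 1 / y ^ β := by
          rw [← Real.rpow_add hy0, one_div, ← Real.rpow_neg hy0.le]
          congr 1
          ring
  set bound : ℝ → ℝ := fun y =>
    (Ioc 0 (max y₀ 1)).indicator (fun _ => (1 : ℝ)) y +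
      (Ioi 1).indicator (fun y => g (1 / y ^ β)) y with hbd
  have hbint : Integrable bound (volume.restrict (Ioi 0)) := by
    refine Integrable.restrict (Integrable.add ?_ ?_)
    · exact (integrable_indicator_iff measurableSet_Ioc).2 (by simp)
    · exact (integrable_indicator_iff measurableSet_Ioi).2 hg
  have hmeas : ∀ x, x₀ ≤ x → AEStronglyMeasurable (fun y => g (T (x * max y 1) / T x))
      (volume.restrict (Ioi 0)) := by
    intro x hx
    have hanti : Antitone fun y => g (T (x * max y 1) / T x) := fun y z hyz =>
      g.monotone_extend (div_le_div_of_nonneg_right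
        (hT (mul_le_mul_of_nonneg_left (max_le_max_right 1 hyz) (hx₀.le.trans hx))) (hpos x).le)
    exact hanti.measurable.aestronglyMeasurable
  have hdom : ∀ x, x₀ ≤ x → ∀ᵐ y ∂volume.restrict (Ioi 0),
      ‖g (T (x * max y 1) / T x)‖ ≤ bound y := by
    intro x hx
    filter_upwards [ae_restrict_mem measurableSet_Ioi] with y hy
    rw [Real.norm_of_nonneg (g.extend_nonneg _)]
    have hnn : 0 ≤ (Ioi 1).indicator (fun y => g (1 / y ^ β)) y :=
      indicator_nonneg (fun y _ => g.extend_nonneg _) y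
    rcases le_or_gt y (max y₀ 1) with hle | hgt
    · simp only [hbd]
      rw [indicator_of_mem (show y ∈ Ioc 0 (max y₀ 1) from ⟨hy, hle⟩)]
      linarith [g.extend_le_one (T (x * max y 1) / T x)]
    · simp only [hbd]
      rw [indicator_of_notMem (fun h => absurd h.2 (not_le.2 hgt)),
        indicator_of_mem (show y ∈ Ioi 1 from (le_max_right _ _).trans_lt hgt), zero_add]
      exact hbound x hx y hgt
  refine ⟨(eventually_ge_atTop x₀).mono fun x hx => Integrable.mono' hbint (hmeas x hx) (hdom x hx), ?_⟩
  have hlim : ∫ y in Ioi (0 : ℝ), g (1 / (max y 1) ^ α) = 1 + ∫ y in Ioi (1 : ℝ), g (1 / y ^ α) := by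
    have h1 : ∀ y ∈ Ioc (0 : ℝ) 1, g (1 / (max y 1) ^ α) = 1 := fun y hy => by
      rw [max_eq_right hy.2, Real.one_rpow, div_one, g.extend_of_one_le le_rfl]
    have h2 : ∀ y ∈ Ioi (1 : ℝ), g (1 / (max y 1) ^ α) = g (1 / y ^ α) := fun y hy => by
      rw [max_eq_left (le_of_lt hy)]
    rw [← Ioc_union_Ioi_eq_Ioi zero_le_one, setIntegral_union (Ioc_disjoint_Ioi le_rfl)
      measurableSet_Ioi, setIntegral_congr_fun measurableSet_Ioc h1,
      setIntegral_congr_fun measurableSet_Ioi h2]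
    · simp
    · exact (integrableOn_congr_fun h1 measurableSet_Ioc).2 (by simp)
    · exact (integrableOn_congr_fun h2 measurableSet_Ioi).2
        (g.integrableOn_one_div_rpow_mono hβ0 hβα.le hg)
  rw [← hlim]
  refine tendsto_integral_filter_of_dominated_convergence bound
    ((eventually_ge_atTop x₀).mono hmeas) ((eventually_ge_atTop x₀).mono hdom) hbint ?_
  rw [← Ioc_union_Ioi_eq_Ioi zero_le_one, ae_restrict_union_iff]
  constructor
  · filter_upwards [ae_restrict_mem measurableSet_Ioc] with y hy
    refine tendsto_const_nhds.congr fun x => ?_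
    rw [max_eq_right hy.2, mul_one, Real.one_rpow, div_one, div_self (hpos x).ne']
  -- `g` need not be continuous: the limit passes through it only where `y ^ (-α)` is a continuity
  -- point, which holds for almost every `y`.
  · filter_upwards [ae_restrict_mem measurableSet_Ioi, DistortionFunction.ae_one_div_rpow_notMem hα
      g.monotone_extend.countable_not_continuousAt] with y hy hc
    rw [not_not] at hc
    rw [mem_Ioi] at hy
    simp only [max_eq_left hy.le]
    refine hc.tendsto.comp ?_
    have := hRV y (one_pos.trans hy)
    rw [Real.rpow_neg (one_pos.trans hy).le, ← one_div] at this
    simpa only [mul_comm] using this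

/-! ### Transfer to sums, non-degeneracy and the tail distortion risk measure -/

theorem tendsto_div_of_tendsto_div {A B W : ℝ → ℝ} {a b : ℝ}
    (hA : Tendsto (fun x => A x / W x) atTop (𝓝 a)) (hB : Tendsto (fun x => B x / W x) atTop (𝓝 b))
    (hb : b ≠ 0) (hW : ∀ᶠ x in atTop, W x ≠ 0) :
    Tendsto (fun x => A x / B x) atTop (𝓝 (a / b)) := by
  refine (hA.div hB hb).congr' ?_
  filter_upwards [hW] with x hx
  exact div_div_div_cancel_right₀ hx _ _

theorem weightedSum_single {Ω : Type*} {n : ℕ} (i : Fin n) (Y : Fin n → Ω → ℝ) :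
    weightedSum (Pi.single i 1) Y = Y i := by
  ext ω
  simp [weightedSum, Pi.single_apply]

theorem weightedSum_one {Ω : Type*} {n : ℕ} (Y : Fin n → Ω → ℝ) (ω : Ω) :
    weightedSum (fun _ => 1) Y ω = ∑ i, Y i ω := by
  simp [weightedSum]

theorem IsRegularlyVarying.tail_of_tendsto_div {V : Measure ℝ} {α : ℝ}
    (hV : IsRegularlyVarying V α) {T : ℝ → ℝ} {c : ℝ} (hc : c ≠ 0)
    (hT : Tendsto (fun x => T x / V.real (Ioi x)) atTop (𝓝 c)) {t : ℝ} (ht : 0 < t) :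
    Tendsto (fun x => T (t * x) / T x) atTop (𝓝 (t ^ (-α))) := by
  have h := (hT.comp (tendsto_id.const_mul_atTop ht)).mul (hV.2 t ht)
  have h' : Tendsto (fun x => T (t * x) / V.real (Ioi x)) atTop (𝓝 (c * t ^ (-α))) := by
    refine h.congr' ?_
    filter_upwards [eventually_gt_atTop 0] with x hx
    exact div_mul_div_cancel₀ (hV.1 _ (mul_pos ht hx)).ne'
  have h2 := tendsto_div_of_tendsto_div h' hT hc
    ((eventually_gt_atTop 0).mono fun x hx => (hV.1 x hx).ne')
  rwa [mul_div_cancel_left₀ _ hc] at h2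

/-- With positive coefficients the functional vanishes only at the origin, which carries no mass. -/
theorem IsMRV.measure_extLinear_ne_zero {P : Measure Ω} {n : ℕ} {Y : Fin n → Ω → ℝ} {α : ℝ}
    {V : Measure ℝ} {μ : Measure (Fin n → ℝ≥0∞)} (h : IsMRV P Y α V μ) {a : Fin n → ℝ}
    (ha : ∀ i, 0 < a i) : μ {y | extLinear a y ≠ 0} ≠ 0 := by
  intro h0
  refine h.ne_zero (Measure.measure_univ_eq_zero.1
    (measure_mono_null (fun y _ => ?_) (measure_union_null h.measure_zero h0)))
  by_cases hy : y = 0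
  · exact Or.inl hy
  · obtain ⟨i, hi⟩ := Function.ne_iff.1 hy
    exact Or.inr (extLinear_ne_zero (ha i) hi)

/-- Makes at least one γ_{eᵢ} positive, hence Γ_α > 0, although individual coordinates may have
negligible tails. -/
theorem IsMRV.exists_measure_coordinate_ne_zero {P : Measure Ω} {n : ℕ} {Y : Fin n → Ω → ℝ}
    {α : ℝ} {V : Measure ℝ} {μ : Measure (Fin n → ℝ≥0∞)} (h : IsMRV P Y α V μ) :
    ∃ i, μ {y | extLinear (Pi.single i 1) y ≠ 0} ≠ 0 := by
  by_contra! hall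
  refine h.ne_zero (Measure.measure_univ_eq_zero.1
    (measure_mono_null (fun y _ => ?_) (measure_union_null h.measure_zero
      (measure_iUnion_null hall))))
  by_cases hy : y = 0
  · exact Or.inl hy
  · obtain ⟨i, hi⟩ := Function.ne_iff.1 hy
    exact Or.inr (mem_iUnion.2 ⟨i, extLinear_ne_zero (by simp) hi⟩)

/-- The maximum with 1 records that below the value at risk the conditioning event already implies
the exceedance. -/
theorem condTail_mul (P : Measure Ω) [IsProbabilityMeasure P] {S : Ω → ℝ} (hS : Measurable S)
    {p : ℝ} (hq : 0 < VaR P S p) (y : ℝ) :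
    condTail P S p (VaR P S p * y) =
      P.real {ω | VaR P S p * max y 1 < S ω} / P.real {ω | VaR P S p < S ω} := by
  have hinter : {ω | VaR P S p < S ω} ∩ {ω | VaR P S p * y < S ω} =
      {ω | VaR P S p * max y 1 < S ω} := by
    ext ω
    rw [mul_max_of_nonneg _ _ hq.le, mul_one]
    simp only [mem_inter_iff, mem_ofPred_eq, max_lt_iff, and_comm]
  rw [condTail, measureReal_def, ProbabilityTheory.cond_apply (measurableSet_lt measurable_const hS),
    hinter, ENNReal.toReal_mul, ENNReal.toReal_inv, mul_comm, ← div_eq_mul_inv]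
  rfl

/-- The tail distortion risk measure of a random variable with a regularly varying tail is finite
near `p = 1` and asymptotically proportional to its value at risk. -/
theorem tendsto_tailDistortionRisk_div_VaR (P : Measure Ω) [IsProbabilityMeasure P] {S : Ω → ℝ}
    (hS : Measurable S) (hpos : ∀ x, 0 < P.real {ω | x < S ω}) {α ζ : ℝ} (hα : 0 < α) (hζ : 0 < ζ)
    (hRV : ∀ t : ℝ, 0 < t →
      Tendsto (fun x => P.real {ω | t * x < S ω} / P.real {ω | x < S ω}) atTop (𝓝 (t ^ (-α))))
    (g : DistortionFunction)
    (hg : IntegrableOn (fun y : ℝ => g (1 / y ^ (α / (1 + ζ)))) (Ioi 1)) :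
    (∀ᶠ p in 𝓝[<] (1 : ℝ), IntegrableOn (fun x : ℝ => g (condTail P S p x)) (Ioi 0)) ∧
      Tendsto (fun p => tailDistortionRisk P g S p / VaR P S p) (𝓝[<] 1)
        (𝓝 (1 + ∫ y in Ioi (1 : ℝ), g (1 / y ^ α))) := by
  have hanti : Antitone fun x => P.real {ω | x < S ω} := fun x y hxy =>
    measureReal_mono (ofPred_subset_ofPred.2 fun ω hω => lt_of_le_of_lt hxy hω)
  obtain ⟨hint, hlim⟩ := tendsto_integral_distorted_ratio hanti hpos hα hζ hRV g hg
  have hq := tendsto_VaR_atTop P hS hpos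
  have hqpos := hq.eventually_gt_atTop 0
  constructor
  · filter_upwards [hqpos, hq.eventually hint] with p hp h
    simp only [← condTail_mul P hS hp] at h
    have h' := (integrableOn_Ioi_comp_mul_left_iff (fun x => g (condTail P S p x)) 0 hp).1 h
    rwa [mul_zero] at h'
  · refine (hlim.comp hq).congr' ?_
    filter_upwards [hqpos] with p hp
    simp only [Function.comp_apply, ← condTail_mul P hS hp]
    rw [integral_comp_mul_left_Ioi (fun x => g (condTail P S p x)) 0 hp, mul_zero, smul_eq_mul,
      tailDistortionRisk, div_eq_inv_mul]

end BackgroundRisk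

/-! ### Assembly of the main theorem -/

theorem mainTheorem6 {Ω : Type*} [MeasurableSpace Ω] (P : Measure Ω) [IsProbabilityMeasure P]
    (n : ℕ) (Θ X : Fin n → Ω → ℝ)
    (hΘ : ∀ i, Measurable (Θ i)) (hX : ∀ i, Measurable (X i))
    (hΘ_nonneg : ∀ i, ∀ᵐ ω ∂P, 0 ≤ Θ i ω) (hX_nonneg : ∀ i, ∀ᵐ ω ∂P, 0 ≤ X i ω)
    (hΘ_nondeg : ∀ i, ¬ ∀ᵐ ω ∂P, Θ i ω = 0)
    (w : Fin n → ℝ) (hw : ∀ i, 0 < w i) (hw_sum : ∑ i, w i = 1)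
    (α : ℝ) (hα : 0 < α) (V : Measure ℝ) (μ : Measure (Fin n → ℝ≥0∞))
    (hMRV : IsMRV P (hadamard Θ X) α V μ)
    (g : DistortionFunction) (ζ : ℝ) (hζ : 0 < ζ)
    (hg : IntegrableOn (fun y : ℝ => g (1 / y ^ (α / (1 + ζ)))) (Ioi 1)) :
    -- the limits `γ_w` and `γ_{e_i}` exist, and the constant below is positive
    Tendsto (tailRatio P (hadamard Θ X) w) atTop (𝓝 (gammaConst P (hadamard Θ X) w)) ∧
    (∀ i, Tendsto (tailRatio P (hadamard Θ X) (Pi.single i 1)) atTop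
      (𝓝 (gammaConst P (hadamard Θ X) (Pi.single i 1)))) ∧
    0 < gammaConst P (hadamard Θ X) w ∧ 0 < GammaConst P (hadamard Θ X) α ∧
    -- both integral forms of `C_α(g)` are finite and agree
    IntegrableOn (fun y : ℝ => y ^ (-1 / α)) (Ioc 0 1) g.stieltjesMeasure ∧
    IntegrableOn (fun y : ℝ => g (1 / y ^ α)) (Ioi 1) ∧
    distortionConstant g α = 1 + ∫ y in Ioi (1 : ℝ), g (1 / y ^ α) ∧
    -- the tail distortion risk measure is finite near `p = 1`
    (∀ᶠ p in 𝓝[<] (1 : ℝ),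
      IntegrableOn (fun x : ℝ => g (condTail P (weightedSum w (hadamard Θ X)) p x)) (Ioi 0)) ∧
    Asymptotics.IsEquivalent (𝓝[<] (1 : ℝ))
      (fun p => tailDistortionRisk P g (weightedSum w (hadamard Θ X)) p)
      (fun p => distortionConstant g α *
        (gammaConst P (hadamard Θ X) w ^ (1 / α) / GammaConst P (hadamard Θ X) α) *
          ∑ i, VaR P (hadamard Θ X i) p) := by
  set Y := hadamard Θ X with hYdef
  have hYm : ∀ i, Measurable (Y i) := fun i => (hΘ i).mul (hX i)
  have hY : ∀ i, ∀ᵐ ω ∂P, 0 ≤ Y i ω := fun i => by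
    filter_upwards [hΘ_nonneg i, hX_nonneg i] with ω h1 h2
    exact mul_nonneg h1 h2
  have hV := hMRV.regularlyVarying
  have hVne : ∀ᶠ x : ℝ in atTop, V.real (Ioi x) ≠ 0 :=
    (eventually_gt_atTop 0).mono fun x hx => (hV.1 x hx).ne'
  have hsingle : ∀ i j : Fin n, (0 : ℝ) ≤ (Pi.single i 1 : Fin n → ℝ) j := fun i j =>
    (Pi.single_nonneg.2 zero_le_one : (0 : Fin n → ℝ) ≤ Pi.single i 1) j
  obtain ⟨c₁, -, hc₁, hlim₁⟩ := hMRV.exists_tendsto_tail hY (a := fun _ => 1) fun _ => zero_le_one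
  replace hc₁ := hc₁ (hMRV.measure_extLinear_ne_zero fun _ => one_pos)
  simp only [weightedSum_one] at hlim₁
  obtain ⟨cw, -, hcw, hlimw⟩ := hMRV.exists_tendsto_tail hY fun i => (hw i).le
  replace hcw := hcw (hMRV.measure_extLinear_ne_zero hw)
  choose c hc0 hcpos hclim using fun i => hMRV.exists_tendsto_tail hY (hsingle i)
  have hratw : Tendsto (tailRatio P Y w) atTop (𝓝 (cw / c₁)) :=
    tendsto_div_of_tendsto_div hlimw hlim₁ hc₁.ne' hVne
  have hrat : ∀ i, Tendsto (tailRatio P Y (Pi.single i 1)) atTop (𝓝 (c i / c₁)) := fun i =>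
    tendsto_div_of_tendsto_div (hclim i) hlim₁ hc₁.ne' hVne
  have hγw : gammaConst P Y w = cw / c₁ := hratw.limUnder_eq
  have hγ : ∀ i, gammaConst P Y (Pi.single i 1) = c i / c₁ := fun i => (hrat i).limUnder_eq
  have hγw_pos : 0 < gammaConst P Y w := hγw ▸ div_pos hcw hc₁
  have hγ_nonneg : ∀ i, 0 ≤ gammaConst P Y (Pi.single i 1) := fun i =>
    hγ i ▸ div_nonneg (hc0 i) hc₁.le
  have hΓ_pos : 0 < GammaConst P Y α := by
    obtain ⟨i, hi⟩ := hMRV.exists_measure_coordinate_ne_zero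
    refine Finset.sum_pos' (fun j _ => Real.rpow_nonneg (hγ_nonneg j) _)
      ⟨i, Finset.mem_univ i, Real.rpow_pos_of_pos ?_ _⟩
    rw [hγ i]
    exact div_pos (hcpos i hi) hc₁
  have hgα : IntegrableOn (fun y : ℝ => g (1 / y ^ α)) (Ioi 1) :=
    g.integrableOn_one_div_rpow_mono (by positivity) (div_le_self hα.le (by linarith)) hg
  have hC := g.distortionConstant_eq hα hgα
  have hC_pos : 0 < distortionConstant g α := by
    rw [hC]
    exact add_pos_of_pos_of_nonneg one_pos (integral_nonneg fun y => g.extend_nonneg _)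
  have hS : Measurable (weightedSum w Y) := by
    unfold weightedSum
    exact Finset.measurable_sum _ fun i _ => (hYm i).const_mul (w i)
  -- The limit gives positivity only far out; monotonicity of the tail carries it back to every `x`.
  have hpos : ∀ x, 0 < P.real {ω | x < weightedSum w Y ω} := fun x => by
    obtain ⟨y, hy, hxy⟩ :=
      ((hlimw.eventually_const_lt hcw).and (eventually_ge_atTop x)).exists
    have hy0 : P.real {ω | y < weightedSum w Y ω} ≠ 0 := fun h => by simp [h] at hy
    exact (measureReal_nonneg.lt_of_ne' hy0).trans_le
      (measureReal_mono (ofPred_subset_ofPred.2 fun ω hω => lt_of_le_of_lt hxy hω))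
  have hRV : ∀ t : ℝ, 0 < t → Tendsto (fun x => P.real {ω | t * x < weightedSum w Y ω} /
      P.real {ω | x < weightedSum w Y ω}) atTop (𝓝 (t ^ (-α))) := fun t ht =>
    hV.tail_of_tendsto_div hcw.ne' hlimw ht
  obtain ⟨hint, hrisk⟩ := tendsto_tailDistortionRisk_div_VaR P hS hpos hα hζ hRV g hg
  refine ⟨hγw ▸ hratw, fun i => hγ i ▸ hrat i, hγw_pos, hΓ_pos,
    g.integrableOn_rpow_stieltjesMeasure hα hgα, hgα, hC, hint, ?_⟩
  rw [← hC] at hrisk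
  have hVaR : ∀ i, Tendsto (fun p => VaR P (Y i) p / VaR P (weightedSum w Y) p) (𝓝[<] 1)
      (𝓝 (gammaConst P Y (Pi.single i 1) ^ (1 / α) / gammaConst P Y w ^ (1 / α))) := fun i => by
    have h := tendsto_div_of_tendsto_div (hclim i) hlimw hcw.ne' hVne
    rw [weightedSum_single] at h
    have h' := tendsto_VaR_div_VaR P (hYm i) hS (hY i) hα (div_nonneg (hc0 i) hcw.le) hpos hRV h
    rwa [← Real.div_rpow (hγ_nonneg i) hγw_pos.le, hγ i, hγw, div_div_div_cancel_right₀ hc₁.ne']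
  have hsum : Tendsto (fun p => (∑ i, VaR P (Y i) p) / VaR P (weightedSum w Y) p) (𝓝[<] 1)
      (𝓝 (GammaConst P Y α / gammaConst P Y w ^ (1 / α))) := by
    simp only [GammaConst, Finset.sum_div]
    exact tendsto_finsetSum _ fun i _ => hVaR i
  have hγp : 0 < gammaConst P Y w ^ (1 / α) := Real.rpow_pos_of_pos hγw_pos _
  have hrhs := hsum.const_mul
    (distortionConstant g α * (gammaConst P Y w ^ (1 / α) / GammaConst P Y α))
  rw [mul_assoc (distortionConstant g α), div_mul_div_cancel₀ hΓ_pos.ne', div_self hγp.ne',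
    mul_one] at hrhs
  refine Asymptotics.isEquivalent_of_tendsto_one ?_
  -- Both sides, divided by `VaR P (weightedSum w Y) p`, tend to the same positive constant C_α(g).
  have hdiv := hrisk.div hrhs hC_pos.ne'
  rw [div_self hC_pos.ne'] at hdiv
  refine hdiv.congr' ?_
  filter_upwards [(tendsto_VaR_atTop P hS hpos).eventually_gt_atTop 0] with p hp
  simp only [Pi.div_apply]
  rw [← mul_div_assoc, div_div_div_cancel_right₀ hp.ne']
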